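/- Let $k\ge 2$ and $\mathcal A_k=\{1,\dots,k\}$. For a sequence $x$ in $\mathcal A_k^{\mathbb N}$ (one-sided) or $\mathcal A_k^{\mathbb Z}$ (two-sided), let $F_x(n)$ be the set of its factors (subwords) of length $n$ and $F_x=\bigcup_n F_x(n)$. A factor $u$ of $x$ is right-special (left-special) if there are letters $a\neq b$ with $ua,ub\in F_x$ (with $au,bu\in F_x$), and bispecial if it is both. The sequence $x$ is an Arnoux-Rauzy sequence if every factor of $x$ occurs with bounded gaps, $|F_x(n)|=(k-1)n+1$ for all $n$, and each $F_x(n)$ contains exactly one right-special and exactly one left-special word. The Arnoux-Rauzy subshift associated with $x$ is the set $X$ of all sequences $y$ (one-sided, resp. two-sided, like $x$) with $F_y(n)=F_x(n)$ for all $n$; put $F_X=F_x$. The index sequence $(i_n)_{n\ge1}$ of $X$ is defined as follows: let $w_1,w_2,\ldots$ be the bispecial words of $F_X$, ordered so that $0=|w_1|<|w_2|<\cdots$; then $i_n$ is the unique letter such that $i_nw_n$ is right-special. Let $X$ be a one-sided or two-sided Arnoux-Rauzy subshift over $\mathcal A_k$ with index sequence $(i_n)$. Then, in $\mathbb N\cup\{\infty\}$,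 $$\sup\{p\in\mathbb N:\text{ there exist words } u_n \text{ with } |u_n|\to\infty \text{ and } u_n^p\in F_X \text{ for all } n\}=2+\limsup_{n\to\infty}e_n,$$ where $e_n=\max\{l\in\mathbb N: i_n=i_{n+1}=\cdots=i_{n+l-1}\}$ is the length of the run of the letter $i_n$ that starts at position $n$. -/

import Mathlib

namespace ArnouxRauzy

/-! Words over an alphabet `A` are lists. Sequences are functions `x : ι → A`, where `ι` is
`ℕ` (one-sided sequences) or `ℤ` (two-sided sequences). -/

/-- The word `x_j x_{j+1} … x_{j+n-1}`. -/
def wordAt {ι A : Type} [AddMonoidWithOne ι] (x : ι → A) (j : ι) (n : ℕ) : List A :=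
  List.ofFn fun t : Fin n => x (j + ((t : ℕ) : ι))

/-- The set `F_x(n)` of all factors of `x` of length `n`. -/
def factorsOfLength {ι A : Type} [AddMonoidWithOne ι] (x : ι → A) (n : ℕ) : Set (List A) :=
  {w | ∃ j : ι, w = wordAt x j n}

/-- The set `F_x` of all factors of `x`. -/
def factors {ι A : Type} [AddMonoidWithOne ι] (x : ι → A) : Set (List A) :=
  {w | ∃ n : ℕ, w ∈ factorsOfLength x n}

/-- `w` has at least two one-letter extensions to the right within the factor set `F`. -/
def IsRightSpecial {A : Type} (F : Set (List A)) (w : List A) : Prop :=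
  w ∈ F ∧ ∃ a b : A, a ≠ b ∧ w ++ [a] ∈ F ∧ w ++ [b] ∈ F

/-- `w` has at least two one-letter extensions to the left within the factor set `F`. -/
def IsLeftSpecial {A : Type} (F : Set (List A)) (w : List A) : Prop :=
  w ∈ F ∧ ∃ a b : A, a ≠ b ∧ a :: w ∈ F ∧ b :: w ∈ F

/-- `w` is both left-special and right-special. -/
def IsBispecial {A : Type} (F : Set (List A)) (w : List A) : Prop :=
  IsLeftSpecial F w ∧ IsRightSpecial F w

/-- Each factor of `x` occurs with bounded gaps. -/
def UniformlyRecurrent {ι A : Type} [AddMonoidWithOne ι] (x : ι → A) : Prop :=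
  ∀ u ∈ factors x, ∃ g : ℕ, ∀ j : ι, ∃ t : ℕ, t ≤ g ∧ wordAt x (j + (t : ι)) u.length = u

/-- `x` is an Arnoux-Rauzy sequence over the alphabet with `k` letters: it is uniformly recurrent,
has complexity `(k - 1) n + 1`, and has exactly one right-special and exactly one left-special
factor of each length. -/
structure IsARSequence {ι : Type} [AddMonoidWithOne ι] {k : ℕ} (x : ι → Fin k) : Prop where
  uniformlyRecurrent : UniformlyRecurrent x
  complexity : ∀ n : ℕ, (factorsOfLength x n).ncard = (k - 1) * n + 1
  rightSpecial : ∀ n : ℕ, ∃! w : List (Fin k), w.length = n ∧ IsRightSpecial (factors x) w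
  leftSpecial : ∀ n : ℕ, ∃! w : List (Fin k), w.length = n ∧ IsLeftSpecial (factors x) w

/-- The subshift associated with `x`: all sequences with the same factors of each length. -/
def subshift {ι A : Type} [AddMonoidWithOne ι] (x : ι → A) : Set (ι → A) :=
  {y | ∀ n : ℕ, factorsOfLength y n = factorsOfLength x n}

/-- `X` is the subshift associated with some Arnoux-Rauzy sequence. -/
def IsARSubshift {ι : Type} [AddMonoidWithOne ι] {k : ℕ} (X : Set (ι → Fin k)) : Prop :=
  ∃ x : ι → Fin k, IsARSequence x ∧ X = subshift x

/-- The set `F_X` of all factors of elements of `X`. -/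
def language {ι A : Type} [AddMonoidWithOne ι] (X : Set (ι → A)) : Set (List A) :=
  {w | ∃ y ∈ X, w ∈ factors y}

/-- `i` is the index sequence of the factor set `F`: the bispecial words of `F` are enumerated
by strictly increasing length as `w 0, w 1, w 2, …`, and `i n` is the (unique) letter
such that `(i n) (w n)` is right-special. Positions are counted from `0`. -/
def IsIndexSequence {A : Type} (F : Set (List A)) (i : ℕ → A) : Prop :=
  ∃ w : ℕ → List A,
    StrictMono (fun n => (w n).length) ∧
    Set.range w = {v | IsBispecial F v} ∧
    ∀ n : ℕ, ∀ a : A, IsRightSpecial F (a :: w n) ↔ a = i n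

/-- The `p`-th power `u^p = u u … u` of a word. -/
def wordPow {A : Type} (u : List A) (p : ℕ) : List A :=
  (List.replicate p u).flatten

/-- The supremum, in `ℕ ∪ {∞}`, of all `p` such that there are words `u_n` with `|u_n| → ∞` and
`u_n ^ p ∈ F` for every `n`. -/
noncomputable def longIndex {A : Type} (F : Set (List A)) : ℕ∞ :=
  sSup {q : ℕ∞ | ∃ p : ℕ, q = (p : ℕ∞) ∧ ∃ u : ℕ → List A,
    Filter.Tendsto (fun n => (u n).length) Filter.atTop Filter.atTop ∧
    ∀ n : ℕ, wordPow (u n) p ∈ F}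

/-- The length, in `ℕ ∪ {∞}`, of the run of the letter `i n` that starts at position `n`:
the largest `l` with `i n = i (n + 1) = … = i (n + l - 1)`. -/
noncomputable def runLength {A : Type} (i : ℕ → A) (n : ℕ) : ℕ∞ :=
  sSup {q : ℕ∞ | ∃ l : ℕ, q = (l : ℕ∞) ∧ ∀ m : ℕ, m < l → i (n + m) = i n}

end ArnouxRauzy

/-!
The proof follows the occurrences of the bispecial words `w_0, w_1, …` in a one-sided sequence.
A two-sided Arnoux-Rauzy sequence has, by uniform recurrence, the same factors as its restriction
to `ℕ`, so one-sided sequences suffice.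

*Return times.* An occurrence of `w_n` followed by the letter `c` is followed by the next occurrence
of `w_n` after a number `P_n(c)` of steps that depends only on `c`, and that next occurrence is
preceded by the same letter `c`. This is proved by induction on `n`
(`IsARSequence.exists_next_bispecial`): if `c = i_n` is the letter for which `c w_n` is
right-special, then `w_{n+1}` is `w_n` continued to its next occurrence after `w_n c`, so that
`|w_{n+1}| = |w_n| + P_n(c)`, `P_{n+1}(c) = P_n(c)`, and `P_{n+1}(b) = P_n(b) + P_n(c)` for `b ≠ c`.
The complexity of `x` enters through the fact that a special factor is extended by every letter.
What remains is arithmetic with this recursion.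

*Upper bound.* A power `u ^ q` in `x` extends to a maximal window of period `|u|`, since `x` is not
periodic on long windows. Without its last period, the window is a bispecial word `w_m` with
`|w_m| ≥ (q - 1) |u|` that recurs after `|u|` steps, whence `P_m(c) ≤ |u|` for the letter `c`
that follows (`IsARSequence.exists_bispecial_of_wordPow`). The recursion gives
`|w_n| + 2 ≤ P_n(b) + P_n(c)` for `b ≠ c`, and hence `|w_m| ≥ 2 P_m(c)` forces `i_{m-1} = c`.
Stripping one index at a time, `i` equals `c` on the `q - 2` positions before `m`
(`exists_run_of_mul_returnTime_le`). No primitivity of `u` is needed.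

*Lower bound.* If `i` equals `c` on the `l` positions from `n` on, and `c` has been an index before,
then `P_n(c) ≤ |w_n|` and `|w_{n+l}| = |w_n| + l P_n(c)`. The word from an occurrence of
`w_{n+l} c` to the end of the next `w_{n+l}` thus has period `p = P_n(c)` and length at least
`(l + 2) p`. As the word gets longer with `n`, aperiodicity makes `p` tend to infinity.
-/

namespace ArnouxRauzy

section Combinatorics

variable {A : Type}

/-! ### Occurrences of words in one-sided sequences -/

/-- The word `w` occurs in `x` at position `j`. -/
def OccursAt (x : ℕ → A) (w : List A) (j : ℕ) : Prop :=
  wordAt x j w.length = w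

@[simp]
theorem length_wordAt {ι : Type} [AddMonoidWithOne ι] (x : ι → A) (j : ι) (n : ℕ) :
    (wordAt x j n).length = n := by
  simp [wordAt]

theorem wordAt_succ (x : ℕ → A) (j n : ℕ) :
    wordAt x j (n + 1) = wordAt x j n ++ [x (j + n)] := by
  simp only [wordAt, List.ofFn_succ_last]
  simp

theorem wordAt_succ' (x : ℕ → A) (j n : ℕ) :
    wordAt x j (n + 1) = x j :: wordAt x (j + 1) n := by
  simp [wordAt, List.ofFn_succ, add_assoc, add_comm 1]

theorem wordAt_add (x : ℕ → A) (j m n : ℕ) :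
    wordAt x j (m + n) = wordAt x j m ++ wordAt x (j + m) n := by
  induction n with
  | zero => simp [wordAt]
  | succ n ih => rw [← add_assoc, wordAt_succ, ih, wordAt_succ, List.append_assoc, add_assoc]

theorem wordAt_eq_wordAt {x : ℕ → A} {i j n : ℕ} :
    wordAt x i n = wordAt x j n ↔ ∀ t < n, x (i + t) = x (j + t) := by
  simp only [wordAt, List.ofFn_inj, funext_iff, Nat.cast_id]
  exact ⟨fun h t ht => h ⟨t, ht⟩, fun h t => h t t.2⟩

theorem mem_factors {x : ℕ → A} {w : List A} : w ∈ factors x ↔ ∃ j, OccursAt x w j := by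
  constructor
  · rintro ⟨n, j, rfl⟩
    exact ⟨j, by simp [OccursAt]⟩
  · rintro ⟨j, h⟩
    exact ⟨w.length, j, h.symm⟩

theorem mem_factorsOfLength {x : ℕ → A} {w : List A} {n : ℕ} :
    w ∈ factorsOfLength x n ↔ w ∈ factors x ∧ w.length = n := by
  constructor
  · rintro ⟨j, rfl⟩
    exact ⟨⟨n, j, rfl⟩, by simp⟩
  · rintro ⟨⟨m, j, rfl⟩, rfl⟩
    exact ⟨j, by simp⟩

theorem occursAt_wordAt (x : ℕ → A) (j n : ℕ) : OccursAt x (wordAt x j n) j := by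
  simp [OccursAt]

theorem OccursAt.agree {x : ℕ → A} {w : List A} {i j : ℕ} (hi : OccursAt x w i)
    (hj : OccursAt x w j) : ∀ t < w.length, x (i + t) = x (j + t) :=
  wordAt_eq_wordAt.1 (hi.trans hj.symm)

theorem occursAt_wordAt_iff {x : ℕ → A} {i j n : ℕ} :
    OccursAt x (wordAt x i n) j ↔ ∀ t < n, x (j + t) = x (i + t) := by
  rw [OccursAt, length_wordAt, wordAt_eq_wordAt]

theorem occursAt_append_singleton {x : ℕ → A} {w : List A} {a : A} {j : ℕ} :
    OccursAt x (w ++ [a]) j ↔ OccursAt x w j ∧ x (j + w.length) = a := by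
  simp [OccursAt, wordAt_succ]

theorem occursAt_cons {x : ℕ → A} {w : List A} {a : A} {j : ℕ} :
    OccursAt x (a :: w) j ↔ x j = a ∧ OccursAt x w (j + 1) := by
  simp [OccursAt, wordAt_succ']

theorem isRightSpecial_iff {x : ℕ → A} {w : List A} :
    IsRightSpecial (factors x) w ↔
      ∃ i j, OccursAt x w i ∧ OccursAt x w j ∧ x (i + w.length) ≠ x (j + w.length) := by
  simp only [IsRightSpecial, mem_factors, occursAt_append_singleton]
  constructor
  · rintro ⟨-, a, b, hab, ⟨i, hi, rfl⟩, ⟨j, hj, rfl⟩⟩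
    exact ⟨i, j, hi, hj, hab⟩
  · rintro ⟨i, j, hi, hj, h⟩
    exact ⟨⟨i, hi⟩, _, _, h, ⟨i, hi, rfl⟩, ⟨j, hj, rfl⟩⟩

theorem isLeftSpecial_iff {x : ℕ → A} {w : List A} :
    IsLeftSpecial (factors x) w ↔
      ∃ i j, OccursAt x w (i + 1) ∧ OccursAt x w (j + 1) ∧ x i ≠ x j := by
  simp only [IsLeftSpecial, mem_factors, occursAt_cons]
  constructor
  · rintro ⟨-, a, b, hab, ⟨i, rfl, hi⟩, ⟨j, rfl, hj⟩⟩
    exact ⟨i, j, hi, hj, hab⟩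
  · rintro ⟨i, j, hi, hj, h⟩
    exact ⟨⟨_, hi⟩, _, _, h, ⟨i, rfl, hi⟩, ⟨j, rfl, hj⟩⟩

theorem OccursAt.append_left {x : ℕ → A} {u v : List A} {j : ℕ} (h : OccursAt x (u ++ v) j) :
    OccursAt x u j := by
  rw [OccursAt, List.length_append, wordAt_add] at h
  exact (List.append_inj h (by simp)).1

theorem OccursAt.append_right {x : ℕ → A} {u v : List A} {j : ℕ} (h : OccursAt x (u ++ v) j) :
    OccursAt x v (j + u.length) := by
  rw [OccursAt, List.length_append, wordAt_add] at h
  exact (List.append_inj h (by simp)).2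

theorem isLeftSpecial_of_append {x : ℕ → A} {u v : List A}
    (h : IsLeftSpecial (factors x) (u ++ v)) : IsLeftSpecial (factors x) u := by
  rw [isLeftSpecial_iff] at h ⊢
  obtain ⟨i, j, hi, hj, hij⟩ := h
  exact ⟨i, j, hi.append_left, hj.append_left, hij⟩

theorem isRightSpecial_of_append {x : ℕ → A} {u v : List A}
    (h : IsRightSpecial (factors x) (u ++ v)) : IsRightSpecial (factors x) v := by
  rw [isRightSpecial_iff] at h ⊢
  obtain ⟨i, j, hi, hj, hij⟩ := h
  exact ⟨_, _, hi.append_right, hj.append_right, by simpa [add_assoc] using hij⟩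

theorem UniformlyRecurrent.exists_ge {x : ℕ → A} (hx : UniformlyRecurrent x) {w : List A}
    (hw : w ∈ factors x) (N : ℕ) : ∃ j ≥ N, OccursAt x w j := by
  obtain ⟨g, hg⟩ := hx w hw
  obtain ⟨t, -, ht⟩ := hg N
  exact ⟨N + t, by omega, ht⟩

/-- If a power `u ^ q` occurs at `j`, then `x` has period `|u|` on the window it covers. -/
theorem wordPow_periodic {x : ℕ → A} {u : List A} {q j : ℕ}
    (h : OccursAt x (wordPow u (q + 1)) j) :
    ∀ t < q * u.length, x (j + t + u.length) = x (j + t) := by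
  have h1 : wordPow u (q + 1) = u ++ wordPow u q := by simp [wordPow, List.replicate_succ]
  have h2 : wordPow u (q + 1) = wordPow u q ++ u := by simp [wordPow, List.replicate_succ']
  have ha := (h1 ▸ h).append_right
  have hb := (h2 ▸ h).append_left
  intro t ht
  have := ha.agree hb t (by simpa [wordPow] using ht)
  rwa [add_right_comm] at this

theorem wordAt_mul_eq_wordPow {x : ℕ → A} {p q j : ℕ}
    (h : ∀ t < q * p, x (j + t + p) = x (j + t)) :
    wordAt x j ((q + 1) * p) = wordPow (wordAt x j p) (q + 1) := by
  induction q with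
  | zero => simp [wordPow]
  | succ q ih =>
    have h3 : wordPow (wordAt x j p) (q + 1 + 1) =
        wordAt x j p ++ wordPow (wordAt x j p) (q + 1) := by
      simp [wordPow, List.replicate_succ]
    have h4 : (q + 1 + 1) * p = p + (q + 1) * p := by ring
    rw [h3, ← ih fun t ht => h t (by nlinarith), h4, wordAt_add]
    congr 1
    rw [wordAt_eq_wordAt]
    intro t ht
    rw [← h t ht, add_right_comm]

/-! ### Return times to bispecial words -/

/-- After each occurrence of `w`, followed by the letter `c`, the next occurrence of `w` comes
exactly `P c` positions later, and it is preceded by the same letter `c`. -/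
structure HasReturnTimes (x : ℕ → A) (w : List A) (P : A → ℕ) : Prop where
  pos : ∀ c, 0 < P c
  /-- The bound says that `w`, then `c`, then the next `w` leave no gap, so that the word from one
  occurrence to the end of the next one is determined by `c`. -/
  le : ∀ c, P c ≤ w.length + 1
  occursAt : ∀ {j}, OccursAt x w j → OccursAt x w (j + P (x (j + w.length)))
  first : ∀ {j}, OccursAt x w j → ∀ t, 0 < t → t < P (x (j + w.length)) → ¬ OccursAt x w (j + t)
  letter : ∀ {j}, OccursAt x w j → x (j + P (x (j + w.length)) - 1) = x (j + w.length)

theorem hasReturnTimes_nil (x : ℕ → A) : HasReturnTimes x [] fun _ => 1 where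
  pos _ := one_pos
  le _ := by simp
  occursAt _ := by simp [OccursAt, wordAt]
  first _ t h0 h1 := by omega
  letter _ := by simp

namespace HasReturnTimes

variable {x : ℕ → A} {w : List A} {P : A → ℕ}

theorem le_of_occursAt (h : HasReturnTimes x w P) {j p : ℕ} (hp : 0 < p) (hj : OccursAt x w j)
    (hjp : OccursAt x w (j + p)) : P (x (j + w.length)) ≤ p := by
  by_contra! hlt
  exact h.first hj p hp hlt hjp

/-- Each occurrence of `w` that has an earlier one is the first return of some earlier one. -/
theorem exists_prev (h : HasReturnTimes x w P) {s j : ℕ} (hs : OccursAt x w s)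
    (hj : OccursAt x w j) (hsj : s < j) :
    ∃ r, s ≤ r ∧ r < j ∧ OccursAt x w r ∧ r + P (x (r + w.length)) = j := by
  classical
  obtain ⟨r, hr, hmax⟩ : ∃ r, (r < j ∧ OccursAt x w r) ∧
      ∀ r', r' < j → OccursAt x w r' → r' ≤ r := by
    refine ⟨Nat.findGreatest (fun r => r < j ∧ OccursAt x w r) j, ?_, ?_⟩
    · exact Nat.findGreatest_spec (P := fun r => r < j ∧ OccursAt x w r) hsj.le ⟨hsj, hs⟩
    · exact fun r' h1 h2 => Nat.le_findGreatest h1.le ⟨h1, h2⟩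
  refine ⟨r, hmax s hsj hs, hr.1, hr.2, ?_⟩
  have h1 := h.le_of_occursAt (p := j - r) (by omega) hr.2 (by
    rwa [Nat.add_sub_of_le hr.1.le])
  have h2 := h.pos (x (r + w.length))
  by_contra hne
  have := hmax _ (by omega) (h.occursAt hr.2)
  omega

/-- Two occurrences of `w` followed by the same letter agree up to the end of the next `w`. -/
theorem agree (h : HasReturnTimes x w P) {i j : ℕ} (hi : OccursAt x w i) (hj : OccursAt x w j)
    (hij : x (i + w.length) = x (j + w.length)) :
    ∀ t < w.length + P (x (i + w.length)), x (i + t) = x (j + t) := by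
  intro t ht
  rcases lt_trichotomy t w.length with h1 | rfl | h1
  · exact hi.agree hj t h1
  · exact hij
  · have h2 := h.le (x (i + w.length))
    have h3 := h.occursAt hi
    have h4 := h.occursAt hj
    rw [← hij] at h4
    have := h3.agree h4 (t - P (x (i + w.length))) (by omega)
    rwa [add_assoc, add_assoc, Nat.add_sub_of_le (by omega)] at this

end HasReturnTimes

/-! ### Consequences of the Arnoux-Rauzy conditions -/

/-- If `g : S → T` is injective off the fibre of `w` and `|S| = |T| + k - 1`, then the fibre of
`w` has at least `k` elements. -/
theorem forall_mem_of_ncard_eq {k : ℕ} {B : Type} {S T : Set B} (hS : S.Finite)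
    (hT : T.Finite) (hcard : S.ncard = T.ncard + (k - 1)) {g : B → B} (hg : Set.MapsTo g S T)
    {w : B} (hw : w ∈ T) {e : Fin k → B} (hinj : ∀ u ∈ S, ∀ v ∈ S, g u = g v → g u ≠ w → u = v)
    (he : ∀ u ∈ S, g u = w → ∃ a, u = e a) (a : Fin k) : e a ∈ S := by
  classical
  by_contra ha
  have h1 : (S \ {u | g u = w}).ncard ≤ (T \ {w}).ncard := by
    refine Set.ncard_le_ncard_of_injOn g ?_ ?_ (hT.subset Set.sdiff_subset)
    · exact fun u hu => ⟨hg hu.1, hu.2⟩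
    · exact fun u hu v hv huv => hinj u hu.1 v hv.1 huv hu.2
  have h2 : (S ∩ {u | g u = w}).ncard ≤ (e '' {b | b ≠ a}).ncard := by
    refine Set.ncard_le_ncard ?_ (Set.toFinite _)
    rintro u ⟨hu, hgu⟩
    obtain ⟨b, rfl⟩ := he u hu hgu
    exact ⟨b, fun hb => ha (hb ▸ hu), rfl⟩
  have h3 : (e '' {b | b ≠ a}).ncard ≤ k - 1 := by
    refine (Set.ncard_image_le (Set.toFinite _)).trans ?_
    have : {b : Fin k | b ≠ a} = ((Finset.univ.erase a : Finset (Fin k)) : Set (Fin k)) := by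
      ext; simp
    rw [this, Set.ncard_coe_finset]
    simp
  have h4 := Set.ncard_inter_add_ncard_sdiff_eq_ncard S {u | g u = w} hS
  have h5 := Set.ncard_sdiff_singleton_add_one hw hT
  omega

namespace IsARSequence

variable {k : ℕ} {x : ℕ → Fin k} {w : List (Fin k)}

theorem finite_factorsOfLength (hx : IsARSequence x) (n : ℕ) : (factorsOfLength x n).Finite :=
  Set.finite_of_ncard_pos (by rw [hx.complexity]; omega)

theorem ncard_succ (hx : IsARSequence x) (n : ℕ) :
    (factorsOfLength x (n + 1)).ncard = (factorsOfLength x n).ncard + (k - 1) := by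
  rw [hx.complexity, hx.complexity]; ring

theorem eq_of_isRightSpecial (hx : IsARSequence x) {u v : List (Fin k)}
    (hu : IsRightSpecial (factors x) u) (hv : IsRightSpecial (factors x) v)
    (h : u.length = v.length) : u = v :=
  (hx.rightSpecial v.length).unique ⟨h, hu⟩ ⟨rfl, hv⟩

theorem eq_of_isLeftSpecial (hx : IsARSequence x) {u v : List (Fin k)}
    (hu : IsLeftSpecial (factors x) u) (hv : IsLeftSpecial (factors x) v)
    (h : u.length = v.length) : u = v :=
  (hx.leftSpecial v.length).unique ⟨h, hu⟩ ⟨rfl, hv⟩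

/-- A right-special factor is extended to the right by every letter. -/
theorem exists_follow (hx : IsARSequence x) (hw : IsRightSpecial (factors x) w) (a : Fin k) :
    ∃ j, OccursAt x w j ∧ x (j + w.length) = a := by
  have key : w ++ [a] ∈ factorsOfLength x (w.length + 1) := by
    refine forall_mem_of_ncard_eq (hx.finite_factorsOfLength _)
      (hx.finite_factorsOfLength w.length) (hx.ncard_succ _) (g := List.dropLast)
      (e := fun a => w ++ [a]) ?_ (mem_factorsOfLength.2 ⟨hw.1, rfl⟩) ?_ ?_ a
    · rintro _ ⟨j, rfl⟩
      exact ⟨j, by simp [wordAt_succ]⟩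
    · rintro _ ⟨i, rfl⟩ _ ⟨j, rfl⟩ hij hne
      rw [wordAt_succ, wordAt_succ, List.dropLast_concat, List.dropLast_concat] at *
      rw [hij] at hne ⊢
      congr 2
      by_contra hx'
      refine hne (hx.eq_of_isRightSpecial (isRightSpecial_iff.2 ⟨i, j, ?_, ?_, ?_⟩) hw (by simp))
      · rw [← hij]; exact occursAt_wordAt ..
      · exact occursAt_wordAt ..
      · simpa using hx'
    · rintro _ ⟨i, rfl⟩ hi
      rw [wordAt_succ, List.dropLast_concat] at *
      exact ⟨_, by rw [hi]⟩
  obtain ⟨j, hj⟩ := mem_factors.1 (mem_factorsOfLength.1 key).1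
  exact ⟨j, occursAt_append_singleton.1 hj⟩

/-- A left-special factor is extended to the left by every letter. -/
theorem exists_precede (hx : IsARSequence x) (hw : IsLeftSpecial (factors x) w) (a : Fin k) :
    ∃ j, x j = a ∧ OccursAt x w (j + 1) := by
  have key : a :: w ∈ factorsOfLength x (w.length + 1) := by
    refine forall_mem_of_ncard_eq (hx.finite_factorsOfLength _)
      (hx.finite_factorsOfLength w.length) (hx.ncard_succ _) (g := List.tail)
      (e := fun a => a :: w) ?_ (mem_factorsOfLength.2 ⟨hw.1, rfl⟩) ?_ ?_ a
    · rintro _ ⟨j, rfl⟩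
      exact ⟨j + 1, by simp [wordAt_succ']⟩
    · rintro _ ⟨i, rfl⟩ _ ⟨j, rfl⟩ hij hne
      rw [wordAt_succ', wordAt_succ', List.tail_cons, List.tail_cons] at *
      rw [hij] at hne ⊢
      congr 1
      by_contra hx'
      refine hne (hx.eq_of_isLeftSpecial (isLeftSpecial_iff.2 ⟨i, j, ?_, ?_, hx'⟩) hw (by simp))
      · rw [← hij]; exact occursAt_wordAt ..
      · exact occursAt_wordAt ..
    · rintro _ ⟨i, rfl⟩ hi
      rw [wordAt_succ', List.tail_cons] at *
      exact ⟨_, by rw [hi]⟩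
  obtain ⟨j, hj⟩ := mem_factors.1 (mem_factorsOfLength.1 key).1
  exact ⟨j, occursAt_cons.1 hj⟩

/-- Windows on which `x` has period `p` have bounded length. The right-special word of length `p`
has two extensions, both of which occur in each long window. -/
theorem exists_not_periodic (hx : IsARSequence x) {p : ℕ} (hp : 0 < p) :
    ∃ N, ∀ j, ∃ t < N, x (j + t + p) ≠ x (j + t) := by
  obtain ⟨w, ⟨hwp, hw⟩, -⟩ := hx.rightSpecial p
  obtain ⟨-, a, b, hab, ha, hb⟩ := hw
  obtain ⟨g, hg⟩ := hx.uniformlyRecurrent _ ha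
  obtain ⟨g', hg'⟩ := hx.uniformlyRecurrent _ hb
  refine ⟨max g g' + 1, fun j => ?_⟩
  by_contra! h
  obtain ⟨t, ht, hta⟩ := hg j
  obtain ⟨t', ht', htb⟩ := hg' j
  obtain ⟨h1, h2⟩ := occursAt_append_singleton.1 hta
  obtain ⟨h3, h4⟩ := occursAt_append_singleton.1 htb
  simp only [Nat.cast_id, hwp] at h1 h2 h3 h4
  refine hab ?_
  rw [← h2, ← h4, h t (by omega), h t' (by omega)]
  exact h1.agree h3 0 (by omega)

variable {P : Fin k → ℕ} {c : Fin k}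

/-- The letter `c` for which `c w` is right-special is also the one for which `w c` is
left-special. Otherwise a letter `d ≠ c` makes `w d` left-special; then `d w` is always followed
by `d`, and since a return to `w` begun by `d` also arrives through `d`, the sequence `x` would
never leave this loop. -/
theorem isLeftSpecial_append (hx : IsARSequence x) (hw : IsBispecial (factors x) w)
    (hP : HasReturnTimes x w P)
    (hc : ∀ a, IsRightSpecial (factors x) (a :: w) ↔ a = c) :
    IsLeftSpecial (factors x) (w ++ [c]) := by
  obtain ⟨v, ⟨hv, hvs⟩, -⟩ := hx.leftSpecial (w.length + 1)
  obtain ⟨u, d, rfl⟩ : ∃ u d, v = u ++ [d] := by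
    rcases List.eq_nil_or_concat v with rfl | ⟨u, d, rfl⟩
    · simp at hv
    · exact ⟨u, d, by simp⟩
  obtain rfl : u = w :=
    hx.eq_of_isLeftSpecial (isLeftSpecial_of_append hvs) hw.1 (by simpa using hv)
  by_cases hdc : d = c
  · exact hdc ▸ hvs
  exfalso
  obtain ⟨s, hsd, hs⟩ := hx.exists_precede hvs d
  obtain ⟨hs, hsd'⟩ := occursAt_append_singleton.1 hs
  have hfollow : ∀ j, OccursAt x u (j + 1) → x j = d → x (j + 1 + u.length) = d := by
    intro j hj hjd
    by_contra hne
    refine hdc ((hc d).1 (isRightSpecial_iff.2 ⟨j, s, occursAt_cons.2 ⟨hjd, hj⟩,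
      occursAt_cons.2 ⟨hsd, hs⟩, fun h => hne ?_⟩))
    simp only [List.length_cons] at h
    rw [← hsd', add_assoc, add_comm 1, h]
    ring_nf
  have hloop : ∀ j, s + 1 ≤ j → OccursAt x u j → x (j + u.length) = d := by
    intro j
    induction j using Nat.strong_induction_on with
    | _ j ih =>
      intro hsj hj
      rcases hsj.eq_or_lt with rfl | hlt
      · exact hsd'
      · obtain ⟨r, hsr, hrj, hr, rfl⟩ := hP.exists_prev hs hj hlt
        have h1 := hP.letter hr
        have h2 := hP.pos (x (r + u.length))
        rw [ih r hrj hsr hr] at h1 h2 hj ⊢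
        obtain ⟨m, hm⟩ : ∃ m, r + P d = m + 1 := ⟨r + P d - 1, by omega⟩
        rw [hm] at h1 hj ⊢
        exact hfollow m hj h1
  obtain ⟨j, hj, hjc⟩ := hx.exists_follow hw.2 c
  obtain ⟨j', hj', hocc⟩ := hx.uniformlyRecurrent.exists_ge
    (mem_factors.2 ⟨j, occursAt_append_singleton.2 ⟨hj, hjc⟩⟩) (s + 1)
  obtain ⟨h1, h2⟩ := occursAt_append_singleton.1 hocc
  exact hdc ((hloop j' hj' h1).symm.trans h2)

/-- If `w` is bispecial and `c w` is right-special, the next bispecial word is `w` continued to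
its next occurrence after `w c`. Of its return times, that of `c` is unchanged, and every other
one grows by the return time of `c`. -/
theorem exists_next_bispecial (hx : IsARSequence x) (hw : IsBispecial (factors x) w)
    (hP : HasReturnTimes x w P)
    (hc : ∀ a, IsRightSpecial (factors x) (a :: w) ↔ a = c) :
    ∃ w', w'.length = w.length + P c ∧ IsBispecial (factors x) w' ∧
      (∀ v, IsBispecial (factors x) v → w.length < v.length → w'.length ≤ v.length) ∧
      HasReturnTimes x w' fun b => if b = c then P c else P b + P c := by
  have hls := hx.isLeftSpecial_append hw hP hc
  -- `b w` is followed by `c` for each letter `b ≠ c`.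
  have hfollow : ∀ j, OccursAt x w (j + 1) → x j ≠ c → x (j + 1 + w.length) = c := by
    intro j hj hjc
    obtain ⟨s, hs, hs'⟩ := hx.exists_precede hls (x j)
    obtain ⟨hs', hsc⟩ := occursAt_append_singleton.1 hs'
    by_contra hne
    refine hjc ((hc (x j)).1 (isRightSpecial_iff.2 ⟨j, s, occursAt_cons.2 ⟨rfl, hj⟩,
      occursAt_cons.2 ⟨hs, hs'⟩, fun h => hne ?_⟩))
    simp only [List.length_cons] at h
    rw [← hsc, add_assoc, add_comm 1, h]
    ring_nf
  have hpc := hP.pos c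
  obtain ⟨i, hi, hic⟩ := hx.exists_follow hw.2 c
  set w' := wordAt x i (w.length + P c) with hw'
  have hlen : w'.length = w.length + P c := by simp [hw']
  have hocc : ∀ j, OccursAt x w' j ↔ OccursAt x w j ∧ x (j + w.length) = c := by
    intro j
    rw [hw', occursAt_wordAt_iff]
    constructor
    · intro h
      refine ⟨?_, by rw [h _ (by omega), hic]⟩
      refine Eq.trans (wordAt_eq_wordAt.2 ?_) hi
      exact fun t ht => h t (by omega)
    · rintro ⟨h1, h2⟩
      have := hP.agree h1 hi (h2.trans hic.symm)
      rwa [h2] at this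
  have hleft : IsLeftSpecial (factors x) w' := by
    obtain ⟨i, j, hi, hj, hij⟩ := isLeftSpecial_iff.1 hls
    exact isLeftSpecial_iff.2 ⟨i, j, (hocc _).2 (occursAt_append_singleton.1 hi),
      (hocc _).2 (occursAt_append_singleton.1 hj), hij⟩
  have hright : IsRightSpecial (factors x) w' := by
    -- Every occurrence of `c w` that is not too far to the left ends an occurrence of `w'`.
    have hback : ∀ a, c :: (w ++ [a]) ∈ factors x →
        ∃ j, OccursAt x w' j ∧ x (j + w'.length) = a := by
      intro a ha
      obtain ⟨j, hj, hoj⟩ := hx.uniformlyRecurrent.exists_ge ha i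
      obtain ⟨h1, h2⟩ := occursAt_cons.1 hoj
      obtain ⟨h2, h3⟩ := occursAt_append_singleton.1 h2
      obtain ⟨r, -, -, hr, hrj⟩ := hP.exists_prev hi h2 (by omega)
      have h4 := hP.letter hr
      rw [hrj, Nat.add_sub_cancel, h1] at h4
      refine ⟨r, (hocc r).2 ⟨hr, h4.symm⟩, ?_⟩
      rw [← h3, ← hrj, ← h4, hlen]
      ring_nf
    obtain ⟨-, a, b, hab, ha, hb⟩ := (hc c).2 rfl
    obtain ⟨j, hj, hja⟩ := hback a ha
    obtain ⟨j', hj', hjb⟩ := hback b hb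
    exact isRightSpecial_iff.2 ⟨j, j', hj, hj', by rwa [hja, hjb]⟩
  refine ⟨w', hlen, ⟨hleft, hright⟩, ?_, ?_⟩
  · intro v hv hlt
    by_contra! hvlt
    -- `v` is both a prefix and a suffix of `w'`, and `w` both a prefix and a suffix of `v`.
    have hpre : v = w'.take v.length :=
      hx.eq_of_isLeftSpecial hv.1
        (isLeftSpecial_of_append (v := w'.drop v.length) (by rwa [List.take_append_drop]))
        (by simp [hvlt.le])
    have hsuf : v = w'.drop (w'.length - v.length) :=
      hx.eq_of_isRightSpecial hv.2
        (isRightSpecial_of_append (u := w'.take (w'.length - v.length))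
          (by rwa [List.take_append_drop]))
        (by simp; omega)
    have hwv : w = v.drop (v.length - w.length) :=
      hx.eq_of_isRightSpecial hw.2
        (isRightSpecial_of_append (u := v.take (v.length - w.length))
          (by rw [List.take_append_drop]; exact hv.2))
        (by simp; omega)
    have h1 : OccursAt x w' i := (hocc i).2 ⟨hi, hic⟩
    have h2 : OccursAt x v i := by
      rw [hpre]
      exact OccursAt.append_left (v := w'.drop v.length) (by rwa [List.take_append_drop])
    have h3 : OccursAt x w (i + (v.length - w.length)) := by
      have := OccursAt.append_right (u := v.take (v.length - w.length))
        (v := v.drop (v.length - w.length)) (by rwa [List.take_append_drop])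
      rwa [← hwv, List.length_take, min_eq_left (by omega)] at this
    refine hP.first hi (v.length - w.length) (by omega) ?_ h3
    rw [hic]; omega
  · refine ⟨?_, ?_, ?_, ?_, ?_⟩
    · intro b
      split_ifs <;> omega
    · intro b
      have := hP.le b
      split_ifs <;> omega
    all_goals
      intro j hj
      obtain ⟨h1, h2⟩ := (hocc j).1 hj
      have h3 := hP.occursAt h1
      have h4 := hP.letter h1
      have h5 := hP.first h1
      rw [h2] at h3 h4 h5
      have h6 : x (j + w'.length) = x (j + P c + w.length) := by rw [hlen]; ring_nf
      rw [h6]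
      generalize hb : x (j + P c + w.length) = b
      have h7 := hP.occursAt h3
      have h8 := hP.letter h3
      have h9 := hP.first h3
      rw [hb] at h7 h8 h9
      have hpb := hP.pos b
    · split_ifs with hbc
      · exact (hocc _).2 ⟨h3, hb.trans hbc⟩
      · rw [add_comm (P b), ← add_assoc]
        obtain ⟨m, hm⟩ : ∃ m, j + P c + P b = m + 1 := ⟨j + P c + P b - 1, by omega⟩
        rw [hm] at h7 h8 ⊢
        exact (hocc _).2 ⟨h7, hfollow m h7 (by rw [Nat.add_sub_cancel] at h8; rwa [h8])⟩
    · intro t ht0 ht hot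
      obtain ⟨h10, h11⟩ := (hocc _).1 hot
      rcases lt_trichotomy t (P c) with hlt | rfl | hlt
      · exact h5 t ht0 hlt h10
      · rw [hb] at h11
        rw [if_pos h11] at ht
        exact lt_irrefl _ ht
      · split_ifs at ht with hbc
        · omega
        · refine h9 (t - P c) (by omega) (by omega) ?_
          rwa [add_assoc, Nat.add_sub_of_le hlt.le]
    · split_ifs with hbc
      · rw [h4, hbc]
      · rw [add_comm (P b), ← add_assoc, h8]

end IsARSequence

/-! ### Lengths and return times in terms of the index sequence -/

variable [DecidableEq A]

/-- The return time, begun by the letter `b`, of the `n`-th bispecial word, computed from the index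
sequence `i`. -/
def returnTime (i : ℕ → A) : ℕ → A → ℕ
  | 0, _ => 1
  | n + 1, b => if b = i n then returnTime i n (i n) else returnTime i n b + returnTime i n (i n)

/-- The length of the `n`-th bispecial word, computed from the index sequence `i`. -/
def bispecialLength (i : ℕ → A) : ℕ → ℕ
  | 0 => 0
  | n + 1 => bispecialLength i n + returnTime i n (i n)

theorem returnTime_succ_self (i : ℕ → A) (n : ℕ) :
    returnTime i (n + 1) (i n) = returnTime i n (i n) := by
  simp [returnTime]

theorem returnTime_pos (i : ℕ → A) (n : ℕ) (b : A) : 0 < returnTime i n b := by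
  induction n generalizing b with
  | zero => simp [returnTime]
  | succ n ih =>
    have := ih (i n)
    simp only [returnTime]
    split_ifs <;> omega

theorem le_bispecialLength (i : ℕ → A) (n : ℕ) : n ≤ bispecialLength i n := by
  induction n with
  | zero => simp
  | succ n ih =>
    have := returnTime_pos i n (i n)
    simp only [bispecialLength]
    omega

theorem bispecialLength_add_two_le (i : ℕ → A) (n : ℕ) {b c : A} (hbc : b ≠ c) :
    bispecialLength i n + 2 ≤ returnTime i n b + returnTime i n c := by
  induction n with
  | zero => simp [bispecialLength, returnTime]
  | succ n ih =>
    simp only [bispecialLength, returnTime]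
    split_ifs with h1 h2 h2
    · exact absurd (h1.trans h2.symm) hbc
    · subst h1; omega
    · subst h2; omega
    · omega

/-- Once a letter has been an index, its return time is at most the length of the word. -/
theorem returnTime_le_of_lt (i : ℕ → A) {m n : ℕ} (hmn : m < n) :
    returnTime i n (i m) ≤ bispecialLength i n := by
  induction n, hmn using Nat.le_induction with
  | base => rw [returnTime_succ_self, bispecialLength]; omega
  | succ n _ ih =>
    simp only [bispecialLength, returnTime]
    split_ifs <;> omega

/-- A bispecial word that is at least twice as long as the return time of `c` comes from a step
with index `c`. -/
theorem eq_of_two_mul_returnTime_le (i : ℕ → A) {m : ℕ} {c : A}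
    (h : 2 * returnTime i m c ≤ bispecialLength i m) : ∃ n, m = n + 1 ∧ i n = c := by
  cases m with
  | zero => simp [returnTime, bispecialLength] at h
  | succ n =>
    refine ⟨n, rfl, ?_⟩
    by_contra hne
    have h1 := bispecialLength_add_two_le i n hne
    simp only [bispecialLength, returnTime, if_neg (Ne.symm hne)] at h
    omega

theorem exists_run_of_mul_returnTime_le (i : ℕ → A) (l : ℕ) {m : ℕ} {c : A}
    (h : (l + 1) * returnTime i m c ≤ bispecialLength i m) :
    ∃ n, m = n + l ∧ ∀ t < l, i (n + t) = c := by
  induction l generalizing m with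
  | zero => exact ⟨m, rfl, by simp⟩
  | succ l ih =>
    have h2 : 2 * returnTime i m c ≤ bispecialLength i m :=
      le_trans (Nat.mul_le_mul_right _ (by omega)) h
    obtain ⟨m, rfl, rfl⟩ := eq_of_two_mul_returnTime_le i h2
    rw [returnTime_succ_self, bispecialLength] at h
    obtain ⟨n, rfl, hn⟩ := ih (m := m) (by nlinarith)
    refine ⟨n, rfl, fun t ht => ?_⟩
    rcases Nat.lt_succ_iff_lt_or_eq.1 ht with h1 | rfl
    · exact hn t h1
    · rfl

theorem returnTime_run (i : ℕ → A) {n l : ℕ} {c : A} (h : ∀ t < l, i (n + t) = c) :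
    returnTime i (n + l) c = returnTime i n c ∧
      bispecialLength i (n + l) = bispecialLength i n + l * returnTime i n c := by
  induction l with
  | zero => simp
  | succ l ih =>
    obtain ⟨h1, h2⟩ := ih fun t ht => h t (by omega)
    have h3 := h l (by omega)
    subst h3
    rw [← add_assoc, returnTime_succ_self, bispecialLength, h1, h2]
    exact ⟨rfl, by ring⟩

/-- The recursively defined lengths and return times are those of the bispecial words. -/
theorem bispecial_spec {k : ℕ} {x : ℕ → Fin k} (hx : IsARSequence x)
    {i : ℕ → Fin k} {w : ℕ → List (Fin k)} (hmono : StrictMono fun n => (w n).length)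
    (hrange : Set.range w = {v | IsBispecial (factors x) v})
    (hi : ∀ n a, IsRightSpecial (factors x) (a :: w n) ↔ a = i n) (n : ℕ) :
    (w n).length = bispecialLength i n ∧ HasReturnTimes x (w n) (returnTime i n) := by
  have hbi : ∀ n, IsBispecial (factors x) (w n) := fun n =>
    (Set.ext_iff.1 hrange (w n)).1 ⟨n, rfl⟩
  induction n with
  | zero =>
    have hnil : IsBispecial (factors x) [] := by
      obtain ⟨u, ⟨hu, hul⟩, -⟩ := hx.leftSpecial 0
      obtain ⟨v, ⟨hv, hvr⟩, -⟩ := hx.rightSpecial 0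
      rw [List.length_eq_zero_iff] at hu hv
      exact ⟨hu ▸ hul, hv ▸ hvr⟩
    obtain ⟨t, ht⟩ := (Set.ext_iff.1 hrange []).2 hnil
    have h0 : w 0 = [] := by
      have := hmono.monotone (Nat.zero_le t)
      simp only [ht, List.length_nil] at this
      exact List.length_eq_zero_iff.1 (by omega)
    rw [h0]
    exact ⟨rfl, hasReturnTimes_nil x⟩
  | succ n ih =>
    obtain ⟨hl, hP⟩ := ih
    obtain ⟨w', hlen, hb, hmin, hP'⟩ := hx.exists_next_bispecial (hbi n) hP (hi n)
    obtain ⟨t, rfl⟩ := (Set.ext_iff.1 hrange w').2 hb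
    have h1 : n < t := by
      refine hmono.lt_iff_lt.1 ?_
      have := returnTime_pos i n (i n)
      omega
    have h2 : t ≤ n + 1 := hmono.le_iff_le.1 (hmin _ (hbi (n + 1)) (hmono (Nat.lt_succ_self n)))
    obtain rfl : t = n + 1 := by omega
    exact ⟨by rw [hlen, hl, bispecialLength], hP'⟩

/-! ### Powers and runs -/

theorem le_runLength_iff {B : Type} {i : ℕ → B} {n l : ℕ} :
    (l : ℕ∞) ≤ runLength i n ↔ ∀ m < l, i (n + m) = i n := by
  constructor
  · intro h m hm
    have h1 : (m : ℕ∞) < runLength i n := lt_of_lt_of_le (by exact_mod_cast hm) h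
    obtain ⟨_, ⟨l', rfl, hl'⟩, hlt⟩ := lt_sSup_iff.1 h1
    exact hl' m (by exact_mod_cast hlt)
  · exact fun h => le_sSup ⟨l, rfl, h⟩

open Filter in
theorem le_limsup_runLength_iff {B : Type} {i : ℕ → B} {l : ℕ} :
    (l : ℕ∞) ≤ limsup (fun n => runLength i n) atTop ↔
      ∃ᶠ n in atTop, ∀ m < l, i (n + m) = i n := by
  simp only [← le_runLength_iff]
  constructor
  · intro h
    cases l with
    | zero => simp [atTop_neBot]
    | succ l =>
      have h1 : (l : ℕ∞) < limsup (fun n => runLength i n) atTop :=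
        lt_of_lt_of_le (by exact_mod_cast Nat.lt_succ_self l) h
      refine (frequently_lt_of_lt_limsup (by isBoundedDefault) h1).mono fun n hn => ?_
      rw [Nat.cast_succ]
      exact Order.add_one_le_of_lt hn
  · exact fun h => le_limsup_of_frequently_le h

/-- A power occurring in `x` extends to a maximal window with the same period. Shortened by one
period, this window is a bispecial word that returns after one period. -/
theorem IsARSequence.exists_bispecial_of_wordPow {k : ℕ} {x : ℕ → Fin k} (hx : IsARSequence x)
    {u : List (Fin k)} {q : ℕ} (hu : 0 < u.length) (h : wordPow u (q + 1) ∈ factors x) :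
    ∃ v j, IsBispecial (factors x) v ∧ q * u.length ≤ v.length ∧
      OccursAt x v j ∧ OccursAt x v (j + u.length) := by
  classical
  set p := u.length with hp
  obtain ⟨N, hN⟩ := hx.exists_not_periodic hu
  obtain ⟨s, -, hs⟩ := hN 0
  rw [zero_add] at hs
  -- An occurrence to the right of a mismatch can be extended to the left up to a mismatch.
  obtain ⟨j, hj, hoj⟩ := hx.uniformlyRecurrent.exists_ge h (s + 1)
  have hper := wordPow_periodic hoj
  rw [← hp] at hper
  obtain ⟨t₀, -, ht₀⟩ := hN j
  obtain ⟨r, hr, hrj, hrmax⟩ : ∃ r, x (r + p) ≠ x r ∧ r < j ∧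
      ∀ t, r < t → t < j → x (t + p) = x t := by
    have hspec := Nat.findGreatest_spec (P := fun r => x (r + p) ≠ x r ∧ r < j) (n := j)
      (by omega) ⟨hs, by omega⟩
    refine ⟨_, hspec.1, hspec.2, fun t ht htj => ?_⟩
    by_contra hne
    exact absurd (Nat.le_findGreatest (P := fun r => x (r + p) ≠ x r ∧ r < j) htj.le ⟨hne, htj⟩)
      (by omega)
  obtain ⟨e, he, hemin⟩ : ∃ e, x (j + e + p) ≠ x (j + e) ∧
      ∀ t < e, x (j + t + p) = x (j + t) :=
    have hex : ∃ e, x (j + e + p) ≠ x (j + e) := ⟨t₀, ht₀⟩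
    ⟨Nat.find hex, Nat.find_spec hex, fun t ht => not_not.1 (Nat.find_min hex ht)⟩
  have hqe : q * p ≤ e := by
    by_contra! hlt
    exact he (hper e hlt)
  have hall : ∀ t < j + e - (r + 1), x (r + 1 + p + t) = x (r + 1 + t) := by
    intro t ht
    rw [add_right_comm]
    rcases lt_or_ge (r + 1 + t) j with h1 | h1
    · exact hrmax _ (by omega) h1
    · have := hemin (r + 1 + t - j) (by omega)
      rwa [Nat.add_sub_of_le h1] at this
  have ho1 := occursAt_wordAt x (r + 1) (j + e - (r + 1))
  have ho2 : OccursAt x (wordAt x (r + 1) (j + e - (r + 1))) (r + 1 + p) :=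
    occursAt_wordAt_iff.2 hall
  refine ⟨_, r + 1, ⟨isLeftSpecial_iff.2 ⟨r, r + p, ho1, ?_, hr.symm⟩,
    isRightSpecial_iff.2 ⟨_, _, ho2, ho1, ?_⟩⟩, ?_, ho1, ho2⟩
  · rwa [add_right_comm]
  · rw [length_wordAt, add_right_comm, Nat.add_sub_of_le (by omega)]
    exact he
  · rw [length_wordAt]; omega

/-- The formula for one-sided sequences. -/
theorem longIndex_eq {k : ℕ} {x : ℕ → Fin k} (hx : IsARSequence x)
    {i : ℕ → Fin k} (hi : IsIndexSequence (factors x) i) :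
    longIndex (factors x) = 2 + Filter.limsup (fun n => runLength i n) Filter.atTop := by
  obtain ⟨w, hmono, hrange, hi⟩ := hi
  have hbi : ∀ n, IsBispecial (factors x) (w n) := fun n =>
    (Set.ext_iff.1 hrange (w n)).1 ⟨n, rfl⟩
  have hspec := bispecial_spec hx hmono hrange hi
  apply le_antisymm
  · refine sSup_le ?_
    rintro _ ⟨q, rfl, u, hu, huF⟩
    rcases Nat.lt_or_ge q 2 with hq | hq
    · -- The bound is trivial for `q ≤ 1`; write `q = 2 + l` otherwise.
      exact le_add_right (by exact_mod_cast hq.le)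
    obtain ⟨l, rfl⟩ := Nat.exists_eq_add_of_le hq
    push_cast
    gcongr
    rw [le_limsup_runLength_iff, Filter.frequently_atTop]
    intro N
    -- A power of a word longer than every `w m` with `m ≤ N + l` only involves later indices.
    obtain ⟨t, ht⟩ := (hu.eventually_ge_atTop (bispecialLength i (N + l) + 1)).exists
    have h1 := huF t
    rw [show 2 + l = (l + 1) + 1 by ring] at h1
    obtain ⟨v, j, hv, hlen, ho1, ho2⟩ := hx.exists_bispecial_of_wordPow (by omega) h1
    obtain ⟨m, rfl⟩ := (Set.ext_iff.1 hrange v).2 hv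
    obtain ⟨hL, hP⟩ := hspec m
    have h2 := hP.le_of_occursAt (by omega) ho1 ho2
    obtain ⟨n, rfl, hn⟩ := exists_run_of_mul_returnTime_le i l
      (le_trans (Nat.mul_le_mul_left (l + 1) h2) (hlen.trans hL.le))
    refine ⟨n, ?_, fun t ht => ?_⟩
    · by_contra! hlt
      have h3 := hmono.monotone (show n + l ≤ N + l by omega)
      rw [(hspec (N + l)).1] at h3
      nlinarith
    · rw [hn t ht]
      exact (hn 0 (by omega)).symm
  · have key : ∀ l : ℕ, (l : ℕ∞) ≤ Filter.limsup (fun n => runLength i n) Filter.atTop →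
        ((2 + l : ℕ) : ℕ∞) ≤ longIndex (factors x) := by
      intro l hl
      wlog hl0 : 0 < l generalizing l
      · refine le_trans ?_ (this 1 ?_ one_pos)
        · exact_mod_cast (by omega)
        · rw [le_limsup_runLength_iff]
          refine Filter.Frequently.of_forall fun n m hm => ?_
          obtain rfl : m = 0 := by omega
          rfl
      rw [le_limsup_runLength_iff, Filter.frequently_atTop] at hl
      suffices h : ∀ M : ℕ, ∃ u : List (Fin k), M ≤ u.length ∧ wordPow u (2 + l) ∈ factors x by
        choose u hu huF using h
        exact le_sSup ⟨2 + l, rfl, u, Filter.tendsto_atTop_mono hu Filter.tendsto_id, huF⟩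
      intro M
      -- Beyond `N₁`, every index has occurred before.
      obtain ⟨N₁, hN₁⟩ : ∃ N₁, ∀ n ≥ N₁, ∃ m < n, i m = i n := by
        choose! f hf using fun (a : Fin k) (h : ∃ m, i m = a) => h
        refine ⟨Finset.univ.sup f + 1, fun n hn => ⟨f (i n), ?_, hf _ ⟨n, rfl⟩⟩⟩
        have := Finset.le_sup (f := f) (Finset.mem_univ (i n))
        omega
      -- No window of length `N₂` has a period in `[1, M]`.
      obtain ⟨N₂, hN₂⟩ : ∃ N₂, ∀ p, 0 < p → p ≤ M → ∀ j, ∃ t < N₂, x (j + t + p) ≠ x (j + t) := by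
        choose! f hf using fun (p : ℕ) (h : 0 < p) => hx.exists_not_periodic h
        refine ⟨(Finset.range (M + 1)).sup f, fun p hp hpM j => ?_⟩
        obtain ⟨t, ht, hne⟩ := hf p hp j
        exact ⟨t, ht.trans_le (Finset.le_sup (Finset.mem_range.2 (by omega))), hne⟩
      obtain ⟨n, hn, hrun⟩ := hl (max N₁ N₂)
      obtain ⟨m, hmn, hm⟩ := hN₁ n (by omega)
      have h1 := returnTime_le_of_lt i hmn
      rw [hm] at h1
      obtain ⟨h2, h3⟩ := returnTime_run i hrun
      obtain ⟨hL, hP⟩ := hspec (n + l)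
      obtain ⟨j, hj, hjc⟩ := hx.exists_follow (hbi (n + l)).2 (i n)
      have h4 := hP.occursAt hj
      rw [hjc, h2] at h4
      set p := returnTime i n (i n) with hp
      have hper : ∀ t < bispecialLength i (n + l), x (j + t + p) = x (j + t) := by
        intro t ht
        rw [add_right_comm]
        exact h4.agree hj t (by omega)
      refine ⟨wordAt x j p, ?_, ?_⟩
      · rw [length_wordAt]
        by_contra! hlt
        obtain ⟨t, ht, hne⟩ := hN₂ p (returnTime_pos ..) hlt.le j
        have := le_bispecialLength i (n + l)
        exact hne (hper t (by omega))
      · rw [show 2 + l = (l + 1) + 1 by ring, ← wordAt_mul_eq_wordPow]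
        · exact ⟨_, j, rfl⟩
        · intro t ht
          exact hper t (by rw [h3]; nlinarith)
    generalize Filter.limsup (fun n => runLength i n) Filter.atTop = s at key
    induction s using ENat.recTopCoe with
    | top =>
      rw [add_top, top_le_iff, ENat.eq_top_iff_forall_ge]
      intro m
      exact le_trans (by exact_mod_cast (by omega)) (key m le_top)
    | coe l => exact_mod_cast key l le_rfl

end Combinatorics

/-! ### Reduction to one-sided sequences -/

theorem language_subshift {ι A : Type} [AddMonoidWithOne ι] (x : ι → A) :
    language (subshift x) = factors x := by
  ext w
  constructor
  · rintro ⟨y, hy, n, hn⟩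
    exact ⟨n, hy n ▸ hn⟩
  · exact fun h => ⟨x, fun _ => rfl, h⟩

theorem wordAt_natCast {A : Type} (x : ℤ → A) (j n : ℕ) :
    wordAt (fun m : ℕ => x m) j n = wordAt x (j : ℤ) n := by
  simp [wordAt]

/-- By uniform recurrence, all factors of a two-sided sequence occur to the right of `0`. -/
theorem factorsOfLength_natCast {A : Type} {x : ℤ → A} (hx : UniformlyRecurrent x) (n : ℕ) :
    factorsOfLength (fun m : ℕ => x m) n = factorsOfLength x n := by
  ext w
  constructor
  · rintro ⟨j, rfl⟩
    exact ⟨j, wordAt_natCast x j n⟩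
  · rintro ⟨j, rfl⟩
    obtain ⟨g, hg⟩ := hx _ ⟨n, j, rfl⟩
    obtain ⟨t, -, ht⟩ := hg 0
    refine ⟨t, ?_⟩
    rw [wordAt_natCast, ← ht, length_wordAt, zero_add]

theorem factors_natCast {A : Type} {x : ℤ → A} (hx : UniformlyRecurrent x) :
    factors (fun m : ℕ => x m) = factors x := by
  simp only [factors, factorsOfLength_natCast hx]

theorem IsARSequence.natCast {k : ℕ} {x : ℤ → Fin k} (hx : IsARSequence x) :
    IsARSequence fun m : ℕ => x m where
  uniformlyRecurrent := by
    intro u hu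
    rw [factors_natCast hx.uniformlyRecurrent] at hu
    obtain ⟨g, hg⟩ := hx.uniformlyRecurrent u hu
    refine ⟨g, fun j => ?_⟩
    obtain ⟨t, ht, h⟩ := hg j
    refine ⟨t, ht, ?_⟩
    rw [wordAt_natCast]
    exact_mod_cast h
  complexity n := by rw [factorsOfLength_natCast hx.uniformlyRecurrent, hx.complexity]
  rightSpecial := by rw [factors_natCast hx.uniformlyRecurrent]; exact hx.rightSpecial
  leftSpecial := by rw [factors_natCast hx.uniformlyRecurrent]; exact hx.leftSpecial

end ArnouxRauzy

theorem mainTheorem4 (k : ℕ) (hk : 2 ≤ k) :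
    (∀ (X : Set (ℕ → Fin k)) (i : ℕ → Fin k),
      ArnouxRauzy.IsARSubshift X →
      ArnouxRauzy.IsIndexSequence (ArnouxRauzy.language X) i →
      ArnouxRauzy.longIndex (ArnouxRauzy.language X)
        = 2 + Filter.limsup (fun n => ArnouxRauzy.runLength i n) Filter.atTop) ∧
    (∀ (X : Set (ℤ → Fin k)) (i : ℕ → Fin k),
      ArnouxRauzy.IsARSubshift X →
      ArnouxRauzy.IsIndexSequence (ArnouxRauzy.language X) i →
      ArnouxRauzy.longIndex (ArnouxRauzy.language X)
        = 2 + Filter.limsup (fun n => ArnouxRauzy.runLength i n) Filter.atTop) := by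
  constructor
  · rintro _ i ⟨x, hx, rfl⟩ hi
    rw [ArnouxRauzy.language_subshift] at hi ⊢
    exact ArnouxRauzy.longIndex_eq hx hi
  · rintro _ i ⟨x, hx, rfl⟩ hi
    rw [ArnouxRauzy.language_subshift,
      ← ArnouxRauzy.factors_natCast hx.uniformlyRecurrent] at hi ⊢
    exact ArnouxRauzy.longIndex_eq hx.natCast hi
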